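/- Let $(M,g)$ be a closed (compact, connected, without boundary) smooth Riemannian manifold. There is a constant $C_5$, depending only on $(M,g)$, such that for every domain (nonempty connected open set) $\Omega\subseteq M$, $$\lambda_1(\Omega)\le \frac{C_5}{\mathrm{inrad}(\Omega)^2}.$$ Here $\lambda_1(\Omega)$ is the first Dirichlet eigenvalue of the Laplace–Beltrami operator on $\Omega$, with no regularity of $\partial\Omega$ assumed, that is, $$\lambda_1(\Omega)=\inf\left\{\frac{\int_M|\nabla f|_g^2\,d\mathrm{vol}_g}{\int_M f^2\,d\mathrm{vol}_g} : f\in C_c^\infty(\Omega),\ f\neq 0\right\},$$ and $\mathrm{inrad}(\Omega)=\sup\{r\ge 0 : B(p,r)\subseteq\Omega \text{ for some } p\in M\}$ is the inner radius of $\Omega$, where $B(p,r)$ is the open ball for the Riemannian distance. (For $\Omega=M$ this reads $\lambda_1(M)=0$, $\mathrm{inrad}(M)=\infty$, and the right-hand side is $0$.) -/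

import Mathlib

open Set MeasureTheory Manifold Bundle
open scoped ENNReal NNReal ContDiff Topology

noncomputable section

namespace RiemGeom

section Volume

variable {n : ℕ} {M : Type*} [TopologicalSpace M] [ChartedSpace (EuclideanSpace ℝ (Fin n)) M]
  [RiemannianBundle (fun x : M ↦ TangentSpace (𝓡 n) x)]

/-- The coordinate vector field `∂ᵢ` of the chart around `x`, at the point with coordinates `y`. -/
def coordVector (x : M) (y : EuclideanSpace ℝ (Fin n)) (i : Fin n) :
    TangentSpace (𝓡 n) ((extChartAt (𝓡 n) x).symm y) :=
  mfderiv 𝓘(ℝ, EuclideanSpace ℝ (Fin n)) (𝓡 n) (extChartAt (𝓡 n) x).symm y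
    (EuclideanSpace.single i (1 : ℝ))

/-- The matrix `gᵢⱼ(y) = g(∂ᵢ, ∂ⱼ)` of the metric in the chart around `x`, at the point with
coordinates `y`. -/
def metricMatrix (x : M) (y : EuclideanSpace ℝ (Fin n)) : Matrix (Fin n) (Fin n) ℝ :=
  Matrix.of fun i j ↦ inner ℝ (coordVector x y i) (coordVector x y j)

variable [MeasurableSpace M]

/-- The measure `√(det gᵢⱼ) dy` of the chart domain around `x`, as a measure on `M` (zero outside
the chart domain). -/
def chartVolume (x : M) : Measure M :=
  ((volume.restrict (extChartAt (𝓡 n) x).target).withDensity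
    (fun y ↦ ENNReal.ofReal (√(metricMatrix x y).det))).map (extChartAt (𝓡 n) x).symm

variable [T2Space M] [SigmaCompactSpace M] [IsManifold (𝓡 n) ∞ M]

variable (n M) in
/-- A smooth partition of unity subordinate to the domains of the preferred charts. -/
def chartPartition : SmoothPartitionOfUnity M (𝓡 n) M univ :=
  (SmoothPartitionOfUnity.exists_isSubordinate_chartAt_source (𝓡 n) M).choose

variable (n M) in
/-- The Riemannian volume measure `∑ₓ ρₓ √(det gᵢⱼ) dy`, where `(ρₓ)` is a smooth partition of unity
subordinate to the chart domains (the result does not depend on the choice). -/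
def riemVolume : Measure M :=
  Measure.sum fun x : M ↦
    (chartVolume (n := n) x).withDensity fun p ↦ ENNReal.ofReal (chartPartition n M x p)

end Volume

section FirstEigenvalue

variable {n : ℕ} {M : Type*} [TopologicalSpace M] [ChartedSpace (EuclideanSpace ℝ (Fin n)) M]

variable (n) in
/-- `f` is a smooth function with compact support contained in `Ω`. -/
def IsTestFunction (Ω : Set M) (f : M → ℝ) : Prop :=
  ContMDiff (𝓡 n) 𝓘(ℝ, ℝ) ∞ f ∧ HasCompactSupport f ∧ tsupport f ⊆ Ω

variable [RiemannianBundle (fun x : M ↦ TangentSpace (𝓡 n) x)]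

/-- The differential of `f` at `p`, as a linear form on the tangent space. -/
def differential (f : M → ℝ) (p : M) : TangentSpace (𝓡 n) p →L[ℝ] ℝ :=
  mfderiv (𝓡 n) 𝓘(ℝ, ℝ) f p

instance (p : M) : FiniteDimensional ℝ (TangentSpace (𝓡 n) p) :=
  inferInstanceAs (FiniteDimensional ℝ (EuclideanSpace ℝ (Fin n)))

/-- The Riemannian gradient: `g(∇f, v) = df(v)` for all tangent vectors `v` at `p`. -/
def riemGradient (f : M → ℝ) (p : M) : TangentSpace (𝓡 n) p :=
  haveI : CompleteSpace (TangentSpace (𝓡 n) p) := FiniteDimensional.complete ℝ _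
  (InnerProductSpace.toDual ℝ (TangentSpace (𝓡 n) p)).symm (differential f p)

variable [MeasurableSpace M] [T2Space M] [SigmaCompactSpace M] [IsManifold (𝓡 n) ∞ M]

variable (n) in
/-- The Rayleigh quotient `∫ |∇f|² dvol / ∫ f² dvol`. -/
def rayleigh (f : M → ℝ) : ℝ≥0∞ :=
  (∫⁻ p, ‖riemGradient (n := n) f p‖ₑ ^ 2 ∂(riemVolume n M)) / (∫⁻ p, ‖f p‖ₑ ^ 2 ∂(riemVolume n M))

variable (n) in
/-- The first Dirichlet eigenvalue `λ₁(Ω)` of an open set `Ω`, with no regularity of the boundary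
assumed: the infimum of the Rayleigh quotient over the nonzero smooth functions compactly supported
in `Ω` (equivalently, over the nonzero elements of their closure `H¹₀(Ω)`). -/
def lambdaOne (Ω : Set M) : ℝ≥0∞ :=
  ⨅ (f : M → ℝ) (_ : IsTestFunction n Ω f) (_ : f ≠ 0), rayleigh n f

end FirstEigenvalue

/-- The inner radius of `Ω`: the supremum of the radii of the balls contained in `Ω`. -/
def inrad {M : Type*} [MetricSpace M] (Ω : Set M) : ℝ≥0∞ :=
  ⨆ (p : M) (r : ℝ≥0) (_ : Metric.ball p (r : ℝ) ⊆ Ω), (r : ℝ≥0∞)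

end RiemGeom

end

/-!
A bump function equal to `1` on a Euclidean ball of radius `s / 2` and supported in the ball of
radius `s` has gradient at most a constant times `1 / s`. Transplanted to `M` by a chart, its
Rayleigh quotient is at most a constant times `1 / s ^ 2`, because near a point the metric is
comparable to the Euclidean metric of the chart and hence the volume is doubling on coordinate
balls. The coordinate ball of radius `r / K` lies in the metric ball of radius `r`, so monotonicity
of `λ₁` bounds `λ₁` of small metric balls, uniformly by compactness. A ball contained in `Ω ≠ M` has
radius at most the diameter of `M`, so shrinking it by a fixed factor makes it small.
-/

namespace RiemGeom

section Dominated

variable {X : Type*} [TopologicalSpace X] [MeasurableSpace X] {μ ν ξ : Measure X} {z : X}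

/-- Local domination of measures: `μ` is at most a constant times `ν` on every measurable set close
enough to `z`. Both directions together compare the Riemannian volume with Lebesgue measure in a
chart without computing it. -/
def DominatedAt (μ ν : Measure X) (z : X) : Prop :=
  ∃ C : ℝ≥0, ∀ᶠ A in (𝓝 z).smallSets, MeasurableSet A → μ A ≤ C * ν A

theorem DominatedAt.of_le (h : μ ≤ ν) : DominatedAt μ ν z :=
  ⟨1, .of_forall fun A _ ↦ by simpa using h A⟩

theorem DominatedAt.trans (h₁ : DominatedAt μ ν z) (h₂ : DominatedAt ν ξ z) :
    DominatedAt μ ξ z := by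
  obtain ⟨C, hC⟩ := h₁
  obtain ⟨D, hD⟩ := h₂
  refine ⟨C * D, ?_⟩
  filter_upwards [hC, hD] with A hA hA' hm
  calc μ A ≤ C * ν A := hA hm
    _ ≤ C * (D * ξ A) := by gcongr; exact hA' hm
    _ = (C * D : ℝ≥0) * ξ A := by push_cast; ring

theorem dominatedAt_withDensity_self {f : X → ℝ≥0∞} (hf : ContinuousAt f z) (hz : f z ≠ ⊤) :
    DominatedAt (μ.withDensity f) μ z := by
  obtain ⟨C, hC⟩ := ENNReal.lt_iff_exists_nnreal_btwn.1 hz.lt_top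
  refine ⟨C, ?_⟩
  filter_upwards [(hf.eventually_lt_const hC.1).smallSets] with A hA hm
  rw [withDensity_apply _ hm, ← setLIntegral_const]
  exact setLIntegral_mono' hm fun p hp ↦ (hA p hp).le

theorem dominatedAt_self_withDensity {f : X → ℝ≥0∞} (hf : ContinuousAt f z) (hz : f z ≠ 0) :
    DominatedAt μ (μ.withDensity f) z := by
  obtain ⟨c, hc, hcz⟩ := ENNReal.lt_iff_exists_nnreal_btwn.1 hz.bot_lt
  have hc0 : c ≠ 0 := by simpa using hc.ne'
  refine ⟨c⁻¹, ?_⟩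
  filter_upwards [(hf.eventually_const_lt hcz).smallSets] with A hA hm
  rw [ENNReal.coe_inv hc0, ← ENNReal.mul_le_iff_le_inv (by simpa) (by simp),
    withDensity_apply _ hm, ← setLIntegral_const]
  exact setLIntegral_mono' hm fun p hp ↦ (hA p hp).le

theorem DominatedAt.sum {ι : Type*} {μ : ι → Measure X} {s : Finset ι}
    (hs : ∀ i ∈ s, DominatedAt (μ i) ν z)
    (hsc : ∀ᶠ A in (𝓝 z).smallSets, MeasurableSet A → ∀ i ∉ s, μ i A = 0) :
    DominatedAt (Measure.sum μ) ν z := by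
  choose! C hC using hs
  refine ⟨∑ i ∈ s, C i, ?_⟩
  filter_upwards [(Filter.eventually_all_finset s).2 hC, hsc] with A hA hAc hm
  rw [Measure.sum_apply _ hm, tsum_eq_sum (hAc hm)]
  push_cast
  rw [Finset.sum_mul]
  exact Finset.sum_le_sum fun i hi ↦ hA i hi hm

end Dominated

theorem tendsto_closedBall_prod_smallSets {X : Type*} [PseudoMetricSpace X] (x : X) :
    Filter.Tendsto (fun q : X × ℝ ↦ Metric.closedBall q.1 q.2) (𝓝 x ×ˢ 𝓝 0) (𝓝 x).smallSets := by
  refine Metric.nhds_basis_ball.smallSets.tendsto_right_iff.2 fun ε hε ↦ ?_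
  have hdist : Filter.Tendsto (fun q : X × ℝ ↦ q.2 + dist q.1 x) (𝓝 x ×ˢ 𝓝 0) (𝓝 0) := by
    have h : Continuous fun q : X × ℝ ↦ q.2 + dist q.1 x := by fun_prop
    simpa [nhds_prod_eq] using h.tendsto (x, 0)
  filter_upwards [hdist.eventually_lt_const hε] with q hq
  exact Metric.closedBall_subset_ball' hq

theorem exists_forall_of_forall_exists_eventually_nhds {X ι : Type*} [TopologicalSpace X]
    [CompactSpace X] [SemilatticeSup ι] [OrderBot ι] {P : ι → X → Prop}
    (hmono : ∀ x, Monotone (P · x)) (h : ∀ x, ∃ C, ∀ᶠ y in 𝓝 x, P C y) : ∃ C, ∀ y, P C y := by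
  choose C hC using h
  obtain ⟨t, ht⟩ := CompactSpace.elim_nhds_subcover _ hC
  refine ⟨t.sup C, fun y ↦ ?_⟩
  obtain ⟨x, hx, hy⟩ := mem_iUnion₂.1 (ht.ge (mem_univ y))
  exact hmono y (Finset.le_sup hx) hy

theorem le_diam_of_ball_subset {X : Type*} [PseudoMetricSpace X] [CompactSpace X] {Ω : Set X}
    (hΩ : Ω ≠ univ) {p : X} {r : ℝ} (hball : Metric.ball p r ⊆ Ω) :
    r ≤ Metric.diam (univ : Set X) := by
  by_contra! hlt
  refine hΩ (univ_subset_iff.1 fun q _ ↦ hball ?_)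
  exact (Metric.dist_le_diam_of_mem isCompact_univ.isBounded (mem_univ q) (mem_univ p)).trans_lt
    hlt

theorem volume_image_le_of_lipschitzOnWith {n : ℕ} {K : ℝ≥0}
    {f : EuclideanSpace ℝ (Fin n) → EuclideanSpace ℝ (Fin n)} {A : Set (EuclideanSpace ℝ (Fin n))}
    (hf : LipschitzOnWith K f A) : volume (f '' A) ≤ (K : ℝ≥0∞) ^ n * volume A := by
  rw [← EuclideanSpace.euclideanHausdorffMeasure_eq_volume,
    Measure.euclideanHausdorffMeasure_def, Measure.smul_apply, Measure.smul_apply,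
    ENNReal.smul_def, ENNReal.smul_def, smul_eq_mul, smul_eq_mul, mul_left_comm]
  gcongr
  simpa using hf.hausdorffMeasure_image_le (d := n) (Nat.cast_nonneg n)

theorem volume_closedBall_eq_mul_half {n : ℕ} (y : EuclideanSpace ℝ (Fin n)) {s : ℝ} (hs : 0 ≤ s) :
    volume (Metric.closedBall y s) = 2 ^ n * volume (Metric.closedBall y (s / 2)) := by
  have h := Measure.addHaar_closedBall_mul volume y zero_le_two (div_nonneg hs zero_le_two)
  rwa [mul_div_cancel₀ s two_ne_zero, finrank_euclideanSpace_fin,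
    ENNReal.ofReal_pow zero_le_two, ENNReal.ofReal_ofNat,
    ← Measure.addHaar_closedBall_center volume y] at h

theorem exists_bump_enorm_fderiv_le (E : Type*) [NormedAddCommGroup E] [NormedSpace ℝ E]
    [HasContDiffBump E] [FiniteDimensional ℝ E] :
    ∃ B : ℝ≥0, ∀ (c : E) (s : ℝ), 0 < s → ∃ ψ : E → ℝ, ContDiff ℝ ∞ ψ ∧
      tsupport ψ ⊆ Metric.closedBall c s ∧ (∀ y ∈ Metric.closedBall c (s / 2), ψ y = 1) ∧
      ∀ y, ‖fderiv ℝ ψ y‖ₑ ≤ B / ENNReal.ofReal s := by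
  let χ : ContDiffBump (0 : E) := ⟨1 / 2, 1, by norm_num, by norm_num⟩
  obtain ⟨B, hB⟩ := (χ.hasCompactSupport.fderiv (𝕜 := ℝ)).exists_bound_of_continuous
    ((χ.contDiff (n := 1)).continuous_fderiv one_ne_zero)
  refine ⟨B.toNNReal, fun c s hs ↦ ?_⟩
  have hnorm (y : E) : ‖s⁻¹ • (y - c)‖ = dist y c / s := by
    rw [norm_smul, norm_inv, Real.norm_of_nonneg hs.le, dist_eq_norm, inv_mul_eq_div]
  refine ⟨fun y ↦ χ (s⁻¹ • (y - c)), ?_, ?_, fun y hy ↦ ?_, fun y ↦ ?_⟩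
  · exact χ.contDiff.comp ((contDiff_id.sub contDiff_const).const_smul s⁻¹)
  · refine closure_minimal (fun y hy ↦ ?_) Metric.isClosed_closedBall
    have hχ : s⁻¹ • (y - c) ∈ Metric.ball 0 χ.rOut := by
      rw [← χ.support_eq]
      exact hy
    rw [mem_ball_zero_iff, hnorm, div_lt_one hs] at hχ
    exact hχ.le
  · refine χ.one_of_mem_closedBall ?_
    rw [mem_closedBall_zero_iff, hnorm, div_le_iff₀ hs, show χ.rIn = 1 / 2 from rfl]
    linarith [Metric.mem_closedBall.1 hy]
  · have hfderiv : fderiv ℝ (fun y ↦ χ (s⁻¹ • (y - c))) y = s⁻¹ • fderiv ℝ χ (s⁻¹ • (y - c)) := by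
      rw [fderiv_comp_sub (f := fun y ↦ χ (s⁻¹ • y)), fderiv_comp_smul]
    rw [hfderiv, ← ofReal_norm, norm_smul, norm_inv, Real.norm_of_nonneg hs.le, inv_mul_eq_div,
      ENNReal.ofReal_div_of_pos hs]
    gcongr
    exact ENNReal.ofReal_le_ofReal (hB _)

theorem lipschitzOnWith_of_enorm_mfderiv_le {F E H N : Type*} [NormedAddCommGroup F]
    [NormedSpace ℝ F] [NormedAddCommGroup E] [NormedSpace ℝ E] [TopologicalSpace H]
    {I : ModelWithCorners ℝ E H} [PseudoEMetricSpace N] [ChartedSpace H N]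
    [RiemannianBundle (fun x : N ↦ TangentSpace I x)] [IsRiemannianManifold I N]
    {f : F → N} {s : Set F} {C : ℝ≥0} (hs : Convex ℝ s) (hso : IsOpen s)
    (hf : ContMDiffOn 𝓘(ℝ, F) I 1 f s)
    (hC : ∀ y ∈ s, ∀ v : F, ‖mfderiv 𝓘(ℝ, F) I f y v‖ₑ ≤ C * ‖v‖ₑ) : LipschitzOnWith C f s := by
  intro y hy y' hy'
  let η := ContinuousAffineMap.lineMap (R := ℝ) y y'
  have hη : MapsTo η (Icc 0 1) s := fun t ht ↦ by
    refine hs.segment_subset hy hy' ?_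
    rw [segment_eq_image_lineMap]
    exact ⟨t, ht, rfl⟩
  have hη1 : ContMDiff 𝓘(ℝ, ℝ) 𝓘(ℝ, F) 1 η :=
    contMDiff_iff_contDiff.2 (ContinuousAffineMap.contDiff _)
  have hle : edist (f y) (f y') ≤ pathELength I (f ∘ η) 0 1 := by
    rw [IsRiemannianManifold.out (I := I)]
    refine riemannianEDist_le_pathELength (hf.comp hη1.contMDiffOn hη) ?_ ?_ zero_le_one <;>
      simp [η, ContinuousAffineMap.coe_lineMap_eq]
  refine hle.trans ?_
  rw [← lintegral_fderiv_lineMap_eq_edist, pathELength_eq_lintegral_mfderivWithin_Icc,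
    ← lintegral_const_mul' _ _ ENNReal.coe_ne_top]
  refine setLIntegral_mono' measurableSet_Icc fun t ht ↦ ?_
  have hchain : mfderivWithin 𝓘(ℝ, ℝ) I (f ∘ η) (Icc 0 1) t =
      (mfderiv 𝓘(ℝ, F) I f (η t)) ∘L (mfderivWithin 𝓘(ℝ, ℝ) 𝓘(ℝ, F) η (Icc 0 1) t) := by
    refine mfderiv_comp_mfderivWithin t ?_ (hη1.contMDiffOn.mdifferentiableOn one_ne_zero t ht)
      (uniqueMDiffWithinAt_iff_uniqueDiffWithinAt.2 (uniqueDiffOn_Icc zero_lt_one t ht))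
    exact (hf.contMDiffAt (hso.mem_nhds (hη ht))).mdifferentiableAt one_ne_zero
  rw [hchain]
  refine (hC _ (hη ht) _).trans_eq ?_
  rw [mfderivWithin_eq_fderivWithin]
  rfl

section ChartMeasure

variable {n : ℕ} {M : Type*} [TopologicalSpace M] [ChartedSpace (EuclideanSpace ℝ (Fin n)) M]
  [MeasurableSpace M] {x x' z : M} {μ ν : Measure (EuclideanSpace ℝ (Fin n))} {A : Set M}

/-- The measure on `M` whose expression in the chart around `x` is `μ`, zero outside the chart
domain. -/
noncomputable def chartMeasure (x : M) (μ : Measure (EuclideanSpace ℝ (Fin n))) : Measure M :=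
  (μ.restrict (extChartAt (𝓡 n) x).target).map (extChartAt (𝓡 n) x).symm

theorem chartVolume_eq_chartMeasure [RiemannianBundle (fun x : M ↦ TangentSpace (𝓡 n) x)]
    (x : M) : chartVolume (n := n) x = chartMeasure x
      (volume.withDensity fun y : EuclideanSpace ℝ (Fin n) ↦
        ENNReal.ofReal √(metricMatrix x y).det) := by
  rw [chartVolume, chartMeasure, restrict_withDensity (isOpen_extChartAt_target x).measurableSet]

variable [BorelSpace M]

theorem measurableSet_target_inter_preimage (hA : MeasurableSet A) :
    MeasurableSet ((extChartAt (𝓡 n) x).target ∩ (extChartAt (𝓡 n) x).symm ⁻¹' A) := by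
  have ht := (isOpen_extChartAt_target (I := 𝓡 n) x).measurableSet
  have hsymm := (continuousOn_extChartAt_symm (I := 𝓡 n) x).domRestrict.measurable hA
  rw [← Subtype.image_preimage_coe]
  exact MeasurableSet.subtype_image ht hsymm

theorem chartMeasure_apply (hA : MeasurableSet A) :
    chartMeasure x μ A = μ ((extChartAt (𝓡 n) x).target ∩ (extChartAt (𝓡 n) x).symm ⁻¹' A) := by
  have ht := (isOpen_extChartAt_target (I := 𝓡 n) x).measurableSet
  rw [chartMeasure, Measure.map_apply_of_aemeasurable
    ((continuousOn_extChartAt_symm x).aemeasurable ht) hA, Measure.restrict_apply' ht, inter_comm]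

theorem chartMeasure_image_symm [T2Space M] {T : Set (EuclideanSpace ℝ (Fin n))}
    (hT : IsCompact T) (hTx : T ⊆ (extChartAt (𝓡 n) x).target) :
    chartMeasure x μ ((extChartAt (𝓡 n) x).symm '' T) = μ T := by
  have hc := hT.image_of_continuousOn ((continuousOn_extChartAt_symm x).mono hTx)
  rw [chartMeasure_apply hc.isClosed.measurableSet, inter_comm, ← PartialEquiv.symm_source,
    (extChartAt (𝓡 n) x).symm.injOn.preimage_image_inter hTx]

theorem DominatedAt.chartMeasure (hz : z ∈ (extChartAt (𝓡 n) x).source)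
    (h : DominatedAt μ ν (extChartAt (𝓡 n) x z)) :
    DominatedAt (chartMeasure x μ) (chartMeasure x ν) z := by
  have hsmall : Filter.Tendsto
      (fun A ↦ (extChartAt (𝓡 n) x).target ∩ (extChartAt (𝓡 n) x).symm ⁻¹' A)
      (𝓝 z).smallSets (𝓝 (extChartAt (𝓡 n) x z)).smallSets := by
    refine Filter.tendsto_smallSets_iff.2 fun U hU ↦ ?_
    filter_upwards [((continuousAt_extChartAt' hz).eventually_mem hU).smallSets]
      with A hA y ⟨hy, hyA⟩
    simpa only [(extChartAt (𝓡 n) x).right_inv hy] using hA _ hyA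
  obtain ⟨C, hC⟩ := h
  refine ⟨C, ?_⟩
  filter_upwards [hsmall.eventually hC] with A hA hm
  simpa only [chartMeasure_apply hm] using hA (measurableSet_target_inter_preimage hm)

theorem dominatedAt_chartMeasure_volume [IsManifold (𝓡 n) 1 M]
    (hx : z ∈ (extChartAt (𝓡 n) x).source) (hx' : z ∈ (extChartAt (𝓡 n) x').source) :
    DominatedAt (chartMeasure (n := n) x' volume) (chartMeasure (n := n) x volume) z := by
  set e := extChartAt (𝓡 n) x
  set e' := extChartAt (𝓡 n) x'
  have hτ : ContDiffAt ℝ 1 (e' ∘ e.symm) (e z) := by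
    have hez : e z ∈ (e.symm.trans e').source := by
      rw [PartialEquiv.trans_source, PartialEquiv.symm_source]
      exact ⟨e.map_source hx, by rwa [mem_preimage, e.left_inv hx]⟩
    have hwithin := contDiffWithinAt_ext_coord_change (n := 1) x' x hez
    rwa [ModelWithCorners.range_eq_univ, contDiffWithinAt_univ] at hwithin
  obtain ⟨K, t, ht, hK⟩ := hτ.exists_lipschitzOnWith
  refine ⟨K ^ n, ?_⟩
  filter_upwards [((continuousAt_extChartAt' hx).eventually_mem ht).smallSets,
    Filter.eventually_smallSets_subset.2 (extChartAt_source_mem_nhds' hx)] with A hAt hAe hm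
  have himage : e'.target ∩ e'.symm ⁻¹' A ⊆ (e' ∘ e.symm) '' (e.target ∩ e.symm ⁻¹' A) := by
    rintro y ⟨hy, hyA⟩
    have hsymm : e.symm (e (e'.symm y)) = e'.symm y := e.left_inv (hAe hyA)
    refine ⟨e (e'.symm y), ⟨e.map_source (hAe hyA), by rwa [mem_preimage, hsymm]⟩, ?_⟩
    rw [Function.comp_apply, hsymm, e'.right_inv hy]
  have hsub : e.target ∩ e.symm ⁻¹' A ⊆ t := by
    rintro y ⟨hy, hyA⟩
    rw [← e.right_inv hy]
    exact hAt _ hyA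
  rw [chartMeasure_apply hm, chartMeasure_apply hm]
  push_cast
  exact (measure_mono himage).trans (volume_image_le_of_lipschitzOnWith (hK.mono hsub))

end ChartMeasure

section VolumeDensity

variable {n : ℕ} {M : Type*} [TopologicalSpace M] [ChartedSpace (EuclideanSpace ℝ (Fin n)) M]
  [IsManifold (𝓡 n) 1 M] {x z : M} {y : EuclideanSpace ℝ (Fin n)}

theorem linearIndependent_coordVector (hy : y ∈ (extChartAt (𝓡 n) x).target) :
    LinearIndependent ℝ (coordVector x y) := by
  have h := isInvertible_mfderivWithin_extChartAt_symm hy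
  rw [ModelWithCorners.range_eq_univ, mfderivWithin_univ] at h
  have hb := (EuclideanSpace.basisFun (Fin n) ℝ).toBasis.linearIndependent
  have hcoord : coordVector x y = (mfderiv 𝓘(ℝ, EuclideanSpace ℝ (Fin n)) (𝓡 n)
      (extChartAt (𝓡 n) x).symm y).toLinearMap ∘ (EuclideanSpace.basisFun (Fin n) ℝ).toBasis := by
    ext1 i
    have hi : EuclideanSpace.single i (1 : ℝ) = (EuclideanSpace.basisFun (Fin n) ℝ).toBasis i := by
      simp
    exact congrArg (mfderiv 𝓘(ℝ, EuclideanSpace ℝ (Fin n)) (𝓡 n) (extChartAt (𝓡 n) x).symm y) hi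
  rw [hcoord]
  exact hb.map' _ (LinearMap.ker_eq_bot.2 h.injective)

theorem continuousOn_coordVector (x : M) (i : Fin n) :
    ContinuousOn
      (fun y ↦ (⟨(extChartAt (𝓡 n) x).symm y, coordVector x y i⟩ : TangentBundle (𝓡 n) M))
      (extChartAt (𝓡 n) x).target := by
  have ho : IsOpen (extChartAt (𝓡 n) x).target := isOpen_extChartAt_target x
  have hsymm := (contMDiffOn_extChartAt_symm (I := 𝓡 n) (n := 1)
    x).continuousOn_tangentMapWithin le_rfl ho.uniqueMDiffOn
  have hconst : Continuous (fun y ↦ (⟨y, EuclideanSpace.single i (1 : ℝ)⟩ :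
      TangentBundle 𝓘(ℝ, EuclideanSpace ℝ (Fin n)) (EuclideanSpace ℝ (Fin n)))) :=
    (contMDiff_vectorSpace_iff_contDiff (n := 0).2 contDiff_const).continuous
  refine (hsymm.comp hconst.continuousOn fun y hy ↦ hy).congr fun y hy ↦ ?_
  simp only [Function.comp_apply, tangentMapWithin, coordVector, mfderivWithin_of_isOpen ho hy]

variable [RiemannianBundle (fun x : M ↦ TangentSpace (𝓡 n) x)]

theorem metricMatrix_det_pos (hy : y ∈ (extChartAt (𝓡 n) x).target) :
    0 < (metricMatrix x y).det :=
  (Matrix.posDef_gram_of_linearIndependent (𝕜 := ℝ)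
    (E := TangentSpace (𝓡 n) ((extChartAt (𝓡 n) x).symm y))
    (linearIndependent_coordVector hy)).det_pos

variable [IsContinuousRiemannianBundle (EuclideanSpace ℝ (Fin n))
  (fun x : M ↦ TangentSpace (𝓡 n) x)]

theorem continuousOn_metricMatrix_det (x : M) :
    ContinuousOn (fun y ↦ (metricMatrix x y).det) (extChartAt (𝓡 n) x).target := by
  have hmatrix : ContinuousOn (fun y ↦ metricMatrix x y) (extChartAt (𝓡 n) x).target :=
    continuousOn_pi.2 fun i ↦ continuousOn_pi.2 fun j ↦
      (continuousOn_coordVector x i).inner_bundle (continuousOn_coordVector x j)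
  exact continuous_id.matrix_det.comp_continuousOn hmatrix

theorem continuousAt_volumeDensity (hy : y ∈ (extChartAt (𝓡 n) x).target) :
    ContinuousAt (fun y ↦ ENNReal.ofReal √(metricMatrix x y).det) y :=
  ENNReal.continuous_ofReal.continuousAt.comp <| Real.continuous_sqrt.continuousAt.comp <|
    (continuousOn_metricMatrix_det x).continuousAt (extChartAt_target_mem_nhds' hy)

variable [MeasurableSpace M] [BorelSpace M]

theorem dominatedAt_chartVolume (hz : z ∈ (extChartAt (𝓡 n) x).source) :
    DominatedAt (chartVolume (n := n) x) (chartMeasure (n := n) x volume) z := by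
  rw [chartVolume_eq_chartMeasure]
  exact (dominatedAt_withDensity_self
    (continuousAt_volumeDensity ((extChartAt (𝓡 n) x).map_source hz))
    ENNReal.ofReal_ne_top).chartMeasure hz

theorem dominatedAt_chartMeasure_chartVolume (hz : z ∈ (extChartAt (𝓡 n) x).source) :
    DominatedAt (chartMeasure (n := n) x volume) (chartVolume (n := n) x) z := by
  have hy := (extChartAt (𝓡 n) x).map_source hz
  have hpos : ENNReal.ofReal √(metricMatrix x (extChartAt (𝓡 n) x z)).det ≠ 0 := by
    simpa using metricMatrix_det_pos hy
  rw [chartVolume_eq_chartMeasure]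
  exact (dominatedAt_self_withDensity (continuousAt_volumeDensity hy) hpos).chartMeasure hz

end VolumeDensity

section Volume

variable {n : ℕ} {M : Type*} [TopologicalSpace M] [ChartedSpace (EuclideanSpace ℝ (Fin n)) M]
  [T2Space M] [SigmaCompactSpace M] [IsManifold (𝓡 n) ∞ M]

theorem tsupport_chartPartition_subset (x : M) :
    tsupport (chartPartition n M x) ⊆ (extChartAt (𝓡 n) x).source := by
  rw [extChartAt_source]
  exact (SmoothPartitionOfUnity.exists_isSubordinate_chartAt_source (𝓡 n) M).choose_spec x

variable [RiemannianBundle (fun x : M ↦ TangentSpace (𝓡 n) x)]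
  [IsContinuousRiemannianBundle (EuclideanSpace ℝ (Fin n)) (fun x : M ↦ TangentSpace (𝓡 n) x)]
  [MeasurableSpace M] [BorelSpace M]

theorem dominatedAt_riemVolume_chartMeasure (z : M) :
    DominatedAt (riemVolume n M) (chartMeasure (n := n) z volume) z := by
  refine DominatedAt.sum (s := (chartPartition n M).fintsupport z) (fun x hx ↦ ?_) ?_
  · have hzx : z ∈ (extChartAt (𝓡 n) x).source :=
      tsupport_chartPartition_subset x ((chartPartition n M).mem_fintsupport_iff z x |>.1 hx)
    have hle : (chartVolume (n := n) x).withDensity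
        (fun p ↦ ENNReal.ofReal (chartPartition n M x p)) ≤ chartVolume (n := n) x := by
      refine (withDensity_mono (.of_forall fun p ↦ ?_)).trans withDensity_one.le
      exact ENNReal.ofReal_le_one.2 ((chartPartition n M).le_one x p)
    exact (DominatedAt.of_le hle).trans <| (dominatedAt_chartVolume hzx).trans <|
      dominatedAt_chartMeasure_volume (mem_extChartAt_source z) hzx
  · filter_upwards [((chartPartition n M).eventually_finsupport_subset z).smallSets]
      with A hA hm x hx
    have hzero : ∀ p ∈ A, ENNReal.ofReal (chartPartition n M x p) = 0 := fun p hp ↦ by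
      have hxp : x ∉ (chartPartition n M).finsupport p := fun h ↦ hx (hA p hp h)
      rw [(chartPartition n M).mem_finsupport, Function.notMem_support] at hxp
      rw [hxp, ENNReal.ofReal_zero]
    rw [withDensity_apply _ hm, setLIntegral_congr_fun hm hzero, lintegral_zero]

theorem dominatedAt_chartMeasure_riemVolume (z : M) :
    DominatedAt (chartMeasure (n := n) z volume) (riemVolume n M) z := by
  obtain ⟨x, hx⟩ := (chartPartition n M).exists_pos_of_mem (mem_univ z)
  have hzx : z ∈ (extChartAt (𝓡 n) x).source :=
    tsupport_chartPartition_subset x (subset_tsupport _ hx.ne')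
  have hρ : ContinuousAt (fun p ↦ ENNReal.ofReal (chartPartition n M x p)) z :=
    (ENNReal.continuous_ofReal.comp (chartPartition n M x).contMDiff.continuous).continuousAt
  exact (dominatedAt_chartMeasure_volume hzx (mem_extChartAt_source z)).trans <|
    (dominatedAt_chartMeasure_chartVolume hzx).trans <|
    (dominatedAt_self_withDensity hρ (by simpa using hx)).trans <| .of_le (Measure.le_sum _ x)

end Volume

section ChartBall

variable {n : ℕ} {M : Type*} [TopologicalSpace M] [ChartedSpace (EuclideanSpace ℝ (Fin n)) M]

/-- The image in `M` of the closed Euclidean ball of center `y` and radius `s` in the chart around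
`z`. Such sets replace metric balls in the estimates: their volumes are controlled by Lebesgue
measure. -/
def chartBall (z : M) (y : EuclideanSpace ℝ (Fin n)) (s : ℝ) : Set M :=
  (extChartAt (𝓡 n) z).symm '' Metric.closedBall y s

variable {z : M} {y : EuclideanSpace ℝ (Fin n)} {s : ℝ}

theorem tendsto_chartBall_smallSets (z : M) :
    Filter.Tendsto (fun q : EuclideanSpace ℝ (Fin n) × ℝ ↦ chartBall z q.1 q.2)
      (𝓝 (extChartAt (𝓡 n) z z) ×ˢ 𝓝 0) (𝓝 z).smallSets := by
  have hsymm := (continuousAt_extChartAt_symm (I := 𝓡 n) z).tendsto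
  rw [extChartAt_to_inv] at hsymm
  exact hsymm.image_smallSets.comp (tendsto_closedBall_prod_smallSets _)

theorem eventually_closedBall_subset_target (z : M) :
    ∀ᶠ q : EuclideanSpace ℝ (Fin n) × ℝ in 𝓝 (extChartAt (𝓡 n) z z) ×ˢ 𝓝 0,
      Metric.closedBall q.1 q.2 ⊆ (extChartAt (𝓡 n) z).target :=
  (tendsto_closedBall_prod_smallSets _).eventually
    (Filter.eventually_smallSets_subset.2 (extChartAt_target_mem_nhds z))

theorem isCompact_chartBall (h : Metric.closedBall y s ⊆ (extChartAt (𝓡 n) z).target) :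
    IsCompact (chartBall z y s) :=
  (isCompact_closedBall y s).image_of_continuousOn ((continuousOn_extChartAt_symm z).mono h)

theorem exists_riemVolume_chartBall_le_mul_half [T2Space M] [SigmaCompactSpace M]
    [IsManifold (𝓡 n) ∞ M] [RiemannianBundle (fun x : M ↦ TangentSpace (𝓡 n) x)]
    [IsContinuousRiemannianBundle (EuclideanSpace ℝ (Fin n)) (fun x : M ↦ TangentSpace (𝓡 n) x)]
    [MeasurableSpace M] [BorelSpace M] (z : M) :
    ∃ C : ℝ≥0, ∀ᶠ q : EuclideanSpace ℝ (Fin n) × ℝ in 𝓝 (extChartAt (𝓡 n) z z) ×ˢ 𝓝[>] 0,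
      riemVolume n M (chartBall z q.1 q.2) ≤ C * riemVolume n M (chartBall z q.1 (q.2 / 2)) := by
  obtain ⟨C, hC⟩ := dominatedAt_riemVolume_chartMeasure (n := n) z
  obtain ⟨D, hD⟩ := dominatedAt_chartMeasure_riemVolume (n := n) z
  have hle : 𝓝 (extChartAt (𝓡 n) z z) ×ˢ 𝓝[>] (0 : ℝ) ≤ 𝓝 (extChartAt (𝓡 n) z z) ×ˢ 𝓝 0 :=
    Filter.prod_mono le_rfl nhdsWithin_le_nhds
  have hhalf : Filter.Tendsto (fun q : EuclideanSpace ℝ (Fin n) × ℝ ↦ (q.1, q.2 / 2))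
      (𝓝 (extChartAt (𝓡 n) z z) ×ˢ 𝓝[>] 0) (𝓝 (extChartAt (𝓡 n) z z) ×ˢ 𝓝 0) := by
    have hdiv : Filter.Tendsto (fun s : ℝ ↦ s / 2) (𝓝 0) (𝓝 0) := by
      simpa using (continuous_id.div_const (2 : ℝ)).tendsto 0
    exact (Filter.tendsto_id.prodMap hdiv).mono_left hle
  refine ⟨C * 2 ^ n * D, ?_⟩
  filter_upwards [((tendsto_chartBall_smallSets z).mono_left hle).eventually hC,
    ((tendsto_chartBall_smallSets z).comp hhalf).eventually hD,
    (eventually_closedBall_subset_target z).filter_mono hle,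
    hhalf.eventually (eventually_closedBall_subset_target z),
    Filter.tendsto_snd.eventually (self_mem_nhdsWithin : Ioi (0 : ℝ) ∈ 𝓝[>] 0)]
    with ⟨y, s⟩ hup hlow hs hs2 hpos
  calc riemVolume n M (chartBall z y s)
      ≤ C * volume (Metric.closedBall y s) := by
        simpa only [chartBall, chartMeasure_image_symm (isCompact_closedBall y s) hs] using
          hup (isCompact_chartBall hs).isClosed.measurableSet
    _ = C * 2 ^ n * volume (Metric.closedBall y (s / 2)) := by
        rw [volume_closedBall_eq_mul_half y (le_of_lt hpos), mul_assoc]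
    _ ≤ C * 2 ^ n * (D * riemVolume n M (chartBall z y (s / 2))) := by
        gcongr
        simpa only [chartBall, Function.comp_apply,
          chartMeasure_image_symm (isCompact_closedBall y (s / 2)) hs2] using
          hlow (isCompact_chartBall hs2).isClosed.measurableSet
    _ = (C * 2 ^ n * D : ℝ≥0) * riemVolume n M (chartBall z y (s / 2)) := by
        push_cast
        ring

end ChartBall

section ChartDistance

variable {n : ℕ} {M : Type*}

attribute [local instance] normedAddCommGroupTangentSpaceVectorSpace
  normedSpaceTangentSpaceVectorSpace

theorem exists_lipschitzOnWith_extChartAt_symm [PseudoEMetricSpace M]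
    [ChartedSpace (EuclideanSpace ℝ (Fin n)) M] [IsManifold (𝓡 n) 1 M]
    [RiemannianBundle (fun x : M ↦ TangentSpace (𝓡 n) x)]
    [IsContinuousRiemannianBundle (EuclideanSpace ℝ (Fin n)) (fun x : M ↦ TangentSpace (𝓡 n) x)]
    [IsRiemannianManifold (𝓡 n) M] (z : M) :
    ∃ K, ∃ t ∈ 𝓝 (extChartAt (𝓡 n) z z), LipschitzOnWith K (extChartAt (𝓡 n) z).symm t := by
  obtain ⟨K, -, hK⟩ := eventually_enorm_mfderivWithin_symm_extChartAt_lt (𝓡 n) z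
  rw [ModelWithCorners.range_eq_univ, nhdsWithin_univ] at hK
  obtain ⟨R, hR, hball⟩ := Metric.mem_nhds_iff.1 (hK.and (extChartAt_target_mem_nhds z))
  refine ⟨K, _, Metric.ball_mem_nhds _ hR, lipschitzOnWith_of_enorm_mfderiv_le (I := 𝓡 n)
    (convex_ball _ _) Metric.isOpen_ball
    ((contMDiffOn_extChartAt_symm z).mono fun y hy ↦ (hball hy).2) fun y hy v ↦ ?_⟩
  have hyK := (hball hy).1
  rw [mfderivWithin_univ] at hyK
  refine (ContinuousLinearMap.le_opENorm _ _).trans ?_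
  gcongr
  · exact hyK.le
  · exact le_rfl

theorem exists_chartBall_subset_ball [PseudoMetricSpace M]
    [ChartedSpace (EuclideanSpace ℝ (Fin n)) M] [IsManifold (𝓡 n) 1 M]
    [RiemannianBundle (fun x : M ↦ TangentSpace (𝓡 n) x)]
    [IsContinuousRiemannianBundle (EuclideanSpace ℝ (Fin n)) (fun x : M ↦ TangentSpace (𝓡 n) x)]
    [IsRiemannianManifold (𝓡 n) M] (z : M) :
    ∃ K : ℝ, 0 < K ∧ ∀ᶠ q : M × ℝ in 𝓝 z ×ˢ 𝓝[>] 0,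
      chartBall z (extChartAt (𝓡 n) z q.1) (q.2 / K) ⊆ Metric.ball q.1 q.2 := by
  obtain ⟨K, t, ht, hK⟩ := exists_lipschitzOnWith_extChartAt_symm (n := n) z
  have hscale : Filter.Tendsto (fun q : M × ℝ ↦ (extChartAt (𝓡 n) z q.1, q.2 / (K + 1)))
      (𝓝 z ×ˢ 𝓝[>] 0) (𝓝 (extChartAt (𝓡 n) z z) ×ˢ 𝓝 0) := by
    have hdiv : Filter.Tendsto (fun r : ℝ ↦ r / (K + 1)) (𝓝[>] 0) (𝓝 0) := by
      simpa using ((continuous_id.div_const (K + 1 : ℝ)).tendsto 0).mono_left nhdsWithin_le_nhds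
    exact (continuousAt_extChartAt z).tendsto.prodMap hdiv
  refine ⟨K + 1, by positivity, ?_⟩
  filter_upwards [hscale.eventually ((tendsto_closedBall_prod_smallSets _).eventually
      (Filter.eventually_smallSets_subset.2 ht)),
    Filter.tendsto_fst.eventually (extChartAt_source_mem_nhds (I := 𝓡 n) z),
    Filter.tendsto_snd.eventually (self_mem_nhdsWithin : Ioi (0 : ℝ) ∈ 𝓝[>] 0)]
    with ⟨p, r⟩ hsub hp hr
  rintro _ ⟨y, hy, rfl⟩
  have hdist := hK.dist_le_mul y (hsub hy) _ (hsub
    (Metric.mem_closedBall_self (div_nonneg (le_of_lt hr) (by positivity))))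
  rw [(extChartAt (𝓡 n) z).left_inv hp] at hdist
  calc dist ((extChartAt (𝓡 n) z).symm y) p
      ≤ K * dist y (extChartAt (𝓡 n) z p) := hdist
    _ ≤ K * (r / (K + 1)) := by gcongr; exact hy
    _ < r := by
      rw [mul_div_assoc', div_lt_iff₀ (by positivity)]
      linarith [show 0 < r from hr]

end ChartDistance

section ChartPullback

variable {n : ℕ} {M : Type*} [TopologicalSpace M] [ChartedSpace (EuclideanSpace ℝ (Fin n)) M]

/-- The function `ψ` of the coordinates of the chart around `z`, extended by zero outside the chart
domain. It transplants Euclidean bump functions to `M`. -/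
noncomputable def chartPullback (z : M) (ψ : EuclideanSpace ℝ (Fin n) → ℝ) : M → ℝ :=
  (extChartAt (𝓡 n) z).source.indicator (ψ ∘ extChartAt (𝓡 n) z)

variable {z : M} {ψ : EuclideanSpace ℝ (Fin n) → ℝ}

theorem chartPullback_extChartAt_symm {y : EuclideanSpace ℝ (Fin n)}
    (hy : y ∈ (extChartAt (𝓡 n) z).target) :
    chartPullback z ψ ((extChartAt (𝓡 n) z).symm y) = ψ y := by
  rw [chartPullback, indicator_of_mem ((extChartAt (𝓡 n) z).map_target hy), Function.comp_apply,
    (extChartAt (𝓡 n) z).right_inv hy]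

theorem chartPullback_eventuallyEq {p : M} (hp : p ∈ (extChartAt (𝓡 n) z).source) :
    chartPullback z ψ =ᶠ[𝓝 p] ψ ∘ extChartAt (𝓡 n) z :=
  eqOn_indicator.eventuallyEq_of_mem (extChartAt_source_mem_nhds' hp)

theorem tsupport_chartPullback_subset [T2Space M] (hψ : HasCompactSupport ψ)
    (hψz : tsupport ψ ⊆ (extChartAt (𝓡 n) z).target) :
    tsupport (chartPullback z ψ) ⊆ (extChartAt (𝓡 n) z).symm '' tsupport ψ := by
  have hc : IsCompact ((extChartAt (𝓡 n) z).symm '' tsupport ψ) :=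
    hψ.image_of_continuousOn ((continuousOn_extChartAt_symm z).mono hψz)
  refine closure_minimal (fun p hp ↦ ?_) hc.isClosed
  obtain ⟨hpz, hpψ⟩ := (indicator_apply_ne_zero (f := ψ ∘ extChartAt (𝓡 n) z)).1 hp
  exact ⟨_, subset_tsupport ψ hpψ, (extChartAt (𝓡 n) z).left_inv hpz⟩

theorem contMDiff_chartPullback [T2Space M] [IsManifold (𝓡 n) ∞ M] (hψ : HasCompactSupport ψ)
    (hψz : tsupport ψ ⊆ (extChartAt (𝓡 n) z).target) (hψ' : ContDiff ℝ ∞ ψ) :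
    ContMDiff (𝓡 n) 𝓘(ℝ, ℝ) ∞ (chartPullback z ψ) := by
  refine contMDiff_of_tsupport fun p hp ↦ ?_
  obtain ⟨y, hy, rfl⟩ := tsupport_chartPullback_subset hψ hψz hp
  have hsource := (extChartAt (𝓡 n) z).map_target (hψz hy)
  refine ContMDiffAt.congr_of_eventuallyEq ?_ (chartPullback_eventuallyEq hsource)
  exact hψ'.contMDiff.contMDiffAt.comp _
    (contMDiffAt_extChartAt' (by rwa [extChartAt_source] at hsource))

theorem isTestFunction_chartPullback [T2Space M] [IsManifold (𝓡 n) ∞ M] {Ω : Set M}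
    (hψ : HasCompactSupport ψ) (hψz : tsupport ψ ⊆ (extChartAt (𝓡 n) z).target)
    (hψ' : ContDiff ℝ ∞ ψ) (hΩ : (extChartAt (𝓡 n) z).symm '' tsupport ψ ⊆ Ω) :
    IsTestFunction n Ω (chartPullback z ψ) := by
  have hsub := tsupport_chartPullback_subset hψ hψz
  refine ⟨contMDiff_chartPullback hψ hψz hψ', ?_, hsub.trans hΩ⟩
  exact (hψ.image_of_continuousOn ((continuousOn_extChartAt_symm z).mono hψz)).of_isClosed_subset
    (isClosed_tsupport _) hsub

theorem differential_chartPullback [IsManifold (𝓡 n) 1 M] {p : M}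
    (hp : p ∈ (extChartAt (𝓡 n) z).source)
    (hψ : DifferentiableAt ℝ ψ (extChartAt (𝓡 n) z p)) :
    differential (n := n) (chartPullback z ψ) p = (fderiv ℝ ψ (extChartAt (𝓡 n) z p)).comp
      (mfderiv (𝓡 n) 𝓘(ℝ, EuclideanSpace ℝ (Fin n)) (extChartAt (𝓡 n) z) p) := by
  rw [differential, (chartPullback_eventuallyEq hp).mfderiv_eq,
    mfderiv_comp p hψ.mdifferentiableAt
      (mdifferentiableAt_extChartAt (by rwa [extChartAt_source] at hp)), mfderiv_eq_fderiv]
  rfl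

end ChartPullback

section Gradient

variable {n : ℕ} {M : Type*} [TopologicalSpace M] [ChartedSpace (EuclideanSpace ℝ (Fin n)) M]
  [RiemannianBundle (fun x : M ↦ TangentSpace (𝓡 n) x)] {p : M}

theorem enorm_riemGradient (f : M → ℝ) (p : M) :
    ‖riemGradient (n := n) f p‖ₑ = ‖differential (n := n) f p‖ₑ :=
  LinearIsometryEquiv.enorm_map _ _

theorem riemGradient_eq_zero_of_notMem_tsupport {f : M → ℝ} (hp : p ∉ tsupport f) :
    riemGradient (n := n) f p = 0 := by
  have h : f =ᶠ[𝓝 p] fun _ ↦ (0 : ℝ) := notMem_tsupport_iff_eventuallyEq.1 hp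
  rw [riemGradient, differential, h.mfderiv_eq, mfderiv_const]
  exact map_zero _

theorem exists_enorm_riemGradient_chartPullback_le [IsManifold (𝓡 n) 1 M]
    [IsContinuousRiemannianBundle (EuclideanSpace ℝ (Fin n)) (fun x : M ↦ TangentSpace (𝓡 n) x)]
    (z : M) : ∃ L : ℝ≥0, ∀ᶠ p in 𝓝 z, ∀ ψ : EuclideanSpace ℝ (Fin n) → ℝ,
      DifferentiableAt ℝ ψ (extChartAt (𝓡 n) z p) → ‖riemGradient (n := n) (chartPullback z ψ) p‖ₑ ≤
        ‖fderiv ℝ ψ (extChartAt (𝓡 n) z p)‖ₑ * L := by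
  obtain ⟨L, -, hL⟩ := eventually_enorm_mfderiv_extChartAt_lt (𝓡 n) z
  refine ⟨L, ?_⟩
  filter_upwards [hL, extChartAt_source_mem_nhds (I := 𝓡 n) z] with p hpL hp ψ hψ
  rw [enorm_riemGradient, differential_chartPullback hp hψ]
  exact (ContinuousLinearMap.opENorm_comp_le _ _).trans (mul_le_mul_right hpL.le _)

end Gradient

section Eigenvalue

variable {n : ℕ} {M : Type*} [TopologicalSpace M] [ChartedSpace (EuclideanSpace ℝ (Fin n)) M]
  [RiemannianBundle (fun x : M ↦ TangentSpace (𝓡 n) x)]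
  [MeasurableSpace M] [T2Space M] [SigmaCompactSpace M] [IsManifold (𝓡 n) ∞ M]

theorem lambdaOne_le_rayleigh {Ω : Set M} {f : M → ℝ} (hf : IsTestFunction n Ω f) (hf0 : f ≠ 0) :
    lambdaOne n Ω ≤ rayleigh n f :=
  iInf_le_of_le f (iInf_le_of_le hf (iInf_le _ hf0))

theorem lambdaOne_anti : Antitone (lambdaOne n : Set M → ℝ≥0∞) := fun _ _ h ↦
  le_iInf fun _ ↦ le_iInf fun hf ↦ le_iInf fun hf0 ↦
    lambdaOne_le_rayleigh ⟨hf.1, hf.2.1, hf.2.2.trans h⟩ hf0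

theorem lambdaOne_univ [CompactSpace M] [Nonempty M] : lambdaOne n (univ : Set M) = 0 := by
  have hgrad (p : M) : riemGradient (n := n) (1 : M → ℝ) p = 0 := by
    rw [riemGradient, differential, Pi.one_def, mfderiv_const]
    exact map_zero _
  have htest : IsTestFunction n univ (1 : M → ℝ) :=
    ⟨contMDiff_const, .of_compactSpace _, subset_univ _⟩
  refine le_antisymm ((lambdaOne_le_rayleigh htest one_ne_zero).trans_eq ?_) zero_le
  simp [rayleigh, hgrad]

theorem rayleigh_le {f : M → ℝ} {S S' : Set M} (hS : MeasurableSet S) (hS' : MeasurableSet S')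
    (hf : tsupport f ⊆ S) (hf1 : ∀ p ∈ S', f p = 1) {G C : ℝ≥0∞}
    (hG : ∀ p ∈ S, ‖riemGradient (n := n) f p‖ₑ ≤ G)
    (hC : riemVolume n M S ≤ C * riemVolume n M S') : rayleigh n f ≤ G ^ 2 * C := by
  refine ENNReal.div_le_of_le_mul ?_
  have henergy : ∫⁻ p, ‖riemGradient (n := n) f p‖ₑ ^ 2 ∂(riemVolume n M) ≤
      G ^ 2 * riemVolume n M S := by
    rw [← lintegral_indicator_const hS]
    refine lintegral_mono fun p ↦ ?_
    by_cases hp : p ∈ S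
    · rw [indicator_of_mem hp]
      gcongr
      exact hG p hp
    · simp [riemGradient_eq_zero_of_notMem_tsupport fun h ↦ hp (hf h)]
  have hmass : riemVolume n M S' ≤ ∫⁻ p, ‖f p‖ₑ ^ 2 ∂(riemVolume n M) := by
    rw [← setLIntegral_one]
    refine (setLIntegral_mono' hS' fun p hp ↦ ?_).trans (setLIntegral_le_lintegral S' _)
    simp [hf1 p hp]
  calc ∫⁻ p, ‖riemGradient (n := n) f p‖ₑ ^ 2 ∂(riemVolume n M)
      ≤ G ^ 2 * riemVolume n M S := henergy
    _ ≤ G ^ 2 * (C * riemVolume n M S') := by gcongr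
    _ ≤ G ^ 2 * C * ∫⁻ p, ‖f p‖ₑ ^ 2 ∂(riemVolume n M) := by
        rw [← mul_assoc]
        gcongr

theorem lambdaOne_image_symm_le [BorelSpace M] {z : M} {ψ : EuclideanSpace ℝ (Fin n) → ℝ}
    {T T' : Set (EuclideanSpace ℝ (Fin n))} (hT : IsCompact T) (hT' : IsCompact T')
    (hTz : T ⊆ (extChartAt (𝓡 n) z).target) (hT'T : T' ⊆ T) (hne : T'.Nonempty)
    (hψ : ContDiff ℝ ∞ ψ) (hψT : tsupport ψ ⊆ T) (hψT' : ∀ y ∈ T', ψ y = 1) {G C : ℝ≥0∞}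
    (hG : ∀ p ∈ (extChartAt (𝓡 n) z).symm '' T,
      ‖riemGradient (n := n) (chartPullback z ψ) p‖ₑ ≤ G)
    (hC : riemVolume n M ((extChartAt (𝓡 n) z).symm '' T) ≤
      C * riemVolume n M ((extChartAt (𝓡 n) z).symm '' T')) :
    lambdaOne n ((extChartAt (𝓡 n) z).symm '' T) ≤ G ^ 2 * C := by
  have hmeas {A : Set (EuclideanSpace ℝ (Fin n))} (hA : IsCompact A) (hAT : A ⊆ T) :
      MeasurableSet ((extChartAt (𝓡 n) z).symm '' A) :=
    (hA.image_of_continuousOn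
      ((continuousOn_extChartAt_symm z).mono (hAT.trans hTz))).isClosed.measurableSet
  have hψc : HasCompactSupport ψ := hT.of_isClosed_subset (isClosed_tsupport ψ) hψT
  have hone : ∀ p ∈ (extChartAt (𝓡 n) z).symm '' T', chartPullback z ψ p = 1 := by
    rintro _ ⟨y, hy, rfl⟩
    rw [chartPullback_extChartAt_symm (hTz (hT'T hy)), hψT' y hy]
  have hf0 : chartPullback z ψ ≠ 0 := fun h ↦ by
    obtain ⟨p, hp⟩ := hne.image (extChartAt (𝓡 n) z).symm
    simpa [h] using hone p hp
  have htest : IsTestFunction n ((extChartAt (𝓡 n) z).symm '' T) (chartPullback z ψ) :=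
    isTestFunction_chartPullback hψc (hψT.trans hTz) hψ (image_mono hψT)
  exact (lambdaOne_le_rayleigh htest hf0).trans
    (rayleigh_le (hmeas hT le_rfl) (hmeas hT' hT'T) htest.2.2 hone hG hC)

theorem exists_lambdaOne_chartBall_mul_sq_le
    [IsContinuousRiemannianBundle (EuclideanSpace ℝ (Fin n)) (fun x : M ↦ TangentSpace (𝓡 n) x)]
    [BorelSpace M] (z : M) :
    ∃ C : ℝ≥0, ∀ᶠ q : EuclideanSpace ℝ (Fin n) × ℝ in 𝓝 (extChartAt (𝓡 n) z z) ×ˢ 𝓝[>] 0,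
      lambdaOne n (chartBall z q.1 q.2) * ENNReal.ofReal q.2 ^ 2 ≤ C := by
  obtain ⟨B, hB⟩ := exists_bump_enorm_fderiv_le (EuclideanSpace ℝ (Fin n))
  obtain ⟨L, hL⟩ := exists_enorm_riemGradient_chartPullback_le (n := n) z
  obtain ⟨C, hC⟩ := exists_riemVolume_chartBall_le_mul_half (n := n) z
  have hle : 𝓝 (extChartAt (𝓡 n) z z) ×ˢ 𝓝[>] (0 : ℝ) ≤ 𝓝 (extChartAt (𝓡 n) z z) ×ˢ 𝓝 0 :=
    Filter.prod_mono le_rfl nhdsWithin_le_nhds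
  refine ⟨(B * L) ^ 2 * C, ?_⟩
  filter_upwards [((tendsto_chartBall_smallSets z).mono_left hle).eventually hL.smallSets, hC,
    (eventually_closedBall_subset_target z).filter_mono hle,
    Filter.tendsto_snd.eventually (self_mem_nhdsWithin : Ioi (0 : ℝ) ∈ 𝓝[>] 0)]
    with ⟨y, s⟩ hgrad hvol hs hpos
  obtain ⟨ψ, hψ, hψs, hψ1, hψB⟩ := hB y s hpos
  have hlambda : lambdaOne n (chartBall z y s) ≤ (B / ENNReal.ofReal s * L) ^ 2 * C := by
    refine lambdaOne_image_symm_le (isCompact_closedBall y s) (isCompact_closedBall y (s / 2)) hs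
      (Metric.closedBall_subset_closedBall (half_le_self (le_of_lt hpos)))
      (Metric.nonempty_closedBall.2 (half_pos hpos).le) hψ hψs hψ1
      (fun p hp ↦ (hgrad p hp ψ (hψ.differentiable (by simp) _)).trans ?_) hvol
    gcongr
    exact hψB _
  calc lambdaOne n (chartBall z y s) * ENNReal.ofReal s ^ 2
      ≤ (B / ENNReal.ofReal s * L) ^ 2 * C * ENNReal.ofReal s ^ 2 := by
        gcongr
    _ = (B / ENNReal.ofReal s * ENNReal.ofReal s * L) ^ 2 * C := by ring
    _ = ((B * L) ^ 2 * C : ℝ≥0) := by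
        rw [ENNReal.div_mul_cancel (by simpa using hpos) ENNReal.ofReal_ne_top]
        push_cast
        rfl

end Eigenvalue

section MetricBalls

variable {n : ℕ} {M : Type*} [MetricSpace M] [SigmaCompactSpace M]
  [ChartedSpace (EuclideanSpace ℝ (Fin n)) M] [IsManifold (𝓡 n) ∞ M]
  [RiemannianBundle (fun x : M ↦ TangentSpace (𝓡 n) x)]
  [IsContinuousRiemannianBundle (EuclideanSpace ℝ (Fin n)) (fun x : M ↦ TangentSpace (𝓡 n) x)]
  [IsRiemannianManifold (𝓡 n) M] [MeasurableSpace M] [BorelSpace M]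

theorem exists_eventually_lambdaOne_ball_mul_sq_le (z : M) :
    ∃ C : ℝ≥0, ∀ᶠ q : M × ℝ in 𝓝 z ×ˢ 𝓝[>] 0,
      lambdaOne n (Metric.ball q.1 q.2) * ENNReal.ofReal q.2 ^ 2 ≤ C := by
  obtain ⟨K, hK, hsub⟩ := exists_chartBall_subset_ball (n := n) z
  obtain ⟨C, hC⟩ := exists_lambdaOne_chartBall_mul_sq_le (n := n) z
  have hscale : Filter.Tendsto (fun q : M × ℝ ↦ (extChartAt (𝓡 n) z q.1, q.2 / K))
      (𝓝 z ×ˢ 𝓝[>] 0) (𝓝 (extChartAt (𝓡 n) z z) ×ˢ 𝓝[>] 0) := by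
    have hdiv : Filter.Tendsto (fun r : ℝ ↦ r / K) (𝓝[>] 0) (𝓝 0) := by
      simpa using ((continuous_id.div_const K).tendsto 0).mono_left nhdsWithin_le_nhds
    have hdivpos : Filter.Tendsto (fun r : ℝ ↦ r / K) (𝓝[>] 0) (𝓝[>] 0) :=
      tendsto_nhdsWithin_iff.2 ⟨hdiv, eventually_mem_nhdsWithin.mono fun r hr ↦ div_pos hr hK⟩
    exact (continuousAt_extChartAt z).tendsto.prodMap hdivpos
  refine ⟨C * K.toNNReal ^ 2, ?_⟩
  filter_upwards [hsub, hscale.eventually hC] with ⟨p, r⟩ hball hbound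
  calc lambdaOne n (Metric.ball p r) * ENNReal.ofReal r ^ 2
      ≤ lambdaOne n (chartBall z (extChartAt (𝓡 n) z p) (r / K)) * ENNReal.ofReal r ^ 2 := by
        gcongr
        exact lambdaOne_anti (n := n) hball
    _ = lambdaOne n (chartBall z (extChartAt (𝓡 n) z p) (r / K)) *
          ENNReal.ofReal (r / K) ^ 2 * ENNReal.ofReal K ^ 2 := by
        rw [mul_assoc, ← mul_pow, ← ENNReal.ofReal_mul' hK.le, div_mul_cancel₀ r hK.ne']
    _ ≤ C * ENNReal.ofReal K ^ 2 := by gcongr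
    _ = (C * K.toNNReal ^ 2 : ℝ≥0) := by push_cast; rfl

theorem exists_eventually_lambdaOne_ball_mul_sq_le_of_le (z : M) (R : ℝ≥0) :
    ∃ C : ℝ≥0, ∀ᶠ p in 𝓝 z, ∀ r ≤ R, lambdaOne n (Metric.ball p r) * (r : ℝ≥0∞) ^ 2 ≤ C := by
  obtain ⟨C, hC⟩ := exists_eventually_lambdaOne_ball_mul_sq_le (n := n) z
  obtain ⟨P, hP, Q, hQ, hPQ⟩ := Filter.eventually_prod_iff.1 hC
  obtain ⟨ε, hε, hεQ⟩ := mem_nhdsGT_iff_exists_Ioc_subset.1 hQ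
  lift ε to ℝ≥0 using le_of_lt hε
  replace hε : 0 < ε := hε
  -- The scale factor that makes `c * r ≤ ε` for all `r ≤ R` while `c ≤ 1`.
  let c : ℝ≥0 := ε / (ε + R)
  have hc : 0 < c := by positivity
  refine ⟨C / c ^ 2, hP.mono fun p hp r hr ↦ ?_⟩
  obtain rfl | hr0 := eq_zero_or_pos r
  · simp
  have hcr : c * r ≤ r := mul_le_of_le_one_left' (div_le_one_of_le₀ le_self_add zero_le)
  have hcε : c * r ≤ ε := by
    rw [div_mul_eq_mul_div, div_le_iff₀ (by positivity)]
    gcongr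
    exact hr.trans le_add_self
  have hbound := hPQ hp (hεQ ⟨by positivity, hcε⟩ : Q ((c * r : ℝ≥0) : ℝ))
  rw [ENNReal.coe_div (by positivity), ENNReal.le_div_iff_mul_le (by simp [hc.ne']) (by simp)]
  calc lambdaOne n (Metric.ball p r) * (r : ℝ≥0∞) ^ 2 * (c ^ 2 : ℝ≥0)
      = lambdaOne n (Metric.ball p r) * ((c * r : ℝ≥0) : ℝ≥0∞) ^ 2 := by
        push_cast
        ring
    _ ≤ lambdaOne n (Metric.ball p (c * r : ℝ≥0)) * ((c * r : ℝ≥0) : ℝ≥0∞) ^ 2 := by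
        gcongr
        exact lambdaOne_anti (Metric.ball_subset_ball hcr)
    _ ≤ C := by simpa using hbound

theorem exists_lambdaOne_ball_mul_sq_le [CompactSpace M] (R : ℝ≥0) :
    ∃ C : ℝ≥0, ∀ p : M, ∀ r ≤ R, lambdaOne n (Metric.ball p r) * (r : ℝ≥0∞) ^ 2 ≤ C :=
  exists_forall_of_forall_exists_eventually_nhds
    (fun _ _ _ hCD h r hr ↦ (h r hr).trans (ENNReal.coe_le_coe.2 hCD))
    fun z ↦ exists_eventually_lambdaOne_ball_mul_sq_le_of_le z R

end MetricBalls

theorem le_div_inrad_sq_iff {M : Type*} [MetricSpace M] {Ω : Set M} {a C : ℝ≥0∞} (hC0 : C ≠ 0)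
    (hC : C ≠ ⊤) :
    a ≤ C / inrad Ω ^ 2 ↔ ∀ (p : M) (r : ℝ≥0), Metric.ball p r ⊆ Ω → a * (r : ℝ≥0∞) ^ 2 ≤ C := by
  rw [ENNReal.le_div_iff_mul_le (.inr hC0) (.inr hC), inrad]
  simp only [ENNReal.iSup_pow_of_ne_zero two_ne_zero, ENNReal.mul_iSup, iSup_le_iff]

theorem isContinuousRiemannianBundle_of_isContMDiffRiemannianBundle {EB HB B F : Type*}
    [NormedAddCommGroup EB] [NormedSpace ℝ EB] [TopologicalSpace HB]
    {IB : ModelWithCorners ℝ EB HB} {k : WithTop ℕ∞} [TopologicalSpace B] [ChartedSpace HB B]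
    [NormedAddCommGroup F] [NormedSpace ℝ F] {E : B → Type*} [TopologicalSpace (TotalSpace F E)]
    [∀ x, NormedAddCommGroup (E x)] [∀ x, InnerProductSpace ℝ (E x)] [FiberBundle F E]
    [VectorBundle ℝ F E] [h : IsContMDiffRiemannianBundle IB k F E] :
    IsContinuousRiemannianBundle F E := by
  obtain ⟨g, hg, hinner⟩ := h.exists_contMDiff
  exact ⟨g, hg.continuous, hinner⟩

end RiemGeom

theorem theorem3_general {n : ℕ} {M : Type*} [MetricSpace M] [CompactSpace M]
    [ChartedSpace (EuclideanSpace ℝ (Fin n)) M] [IsManifold (𝓡 n) ∞ M]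
    [RiemannianBundle (fun x : M ↦ TangentSpace (𝓡 n) x)]
    [IsContinuousRiemannianBundle (EuclideanSpace ℝ (Fin n)) (fun x : M ↦ TangentSpace (𝓡 n) x)]
    [IsRiemannianManifold (𝓡 n) M] [MeasurableSpace M] [BorelSpace M] :
    ∃ C : ℝ≥0, ∀ Ω : Set M, RiemGeom.lambdaOne n Ω ≤ (C : ℝ≥0∞) / RiemGeom.inrad Ω ^ 2 := by
  obtain ⟨C, hC⟩ := RiemGeom.exists_lambdaOne_ball_mul_sq_le (n := n) (M := M)
    (Metric.diam (univ : Set M)).toNNReal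
  refine ⟨C + 1, fun Ω ↦ (RiemGeom.le_div_inrad_sq_iff (by simp) (by simp)).2 fun p r hball ↦ ?_⟩
  obtain rfl | hΩ := eq_or_ne Ω univ
  · have : Nonempty M := ⟨p⟩
    rw [RiemGeom.lambdaOne_univ, zero_mul]
    exact zero_le
  calc RiemGeom.lambdaOne n Ω * (r : ℝ≥0∞) ^ 2
      ≤ RiemGeom.lambdaOne n (Metric.ball p r) * (r : ℝ≥0∞) ^ 2 := by
        gcongr
        exact RiemGeom.lambdaOne_anti hball
    _ ≤ (C : ℝ≥0∞) :=
        hC p r (NNReal.le_toNNReal_of_coe_le (RiemGeom.le_diam_of_ball_subset hΩ hball))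
    _ ≤ ((C + 1 : ℝ≥0) : ℝ≥0∞) := by gcongr; exact le_self_add

/-- On a closed connected Riemannian manifold `M` there is a constant `C` such that
`λ₁(Ω) ≤ C / inrad(Ω)²` for every domain `Ω` in `M`. -/
theorem theorem3 {n : ℕ} {M : Type*} [MetricSpace M] [CompactSpace M] [ConnectedSpace M]
    [ChartedSpace (EuclideanSpace ℝ (Fin n)) M] [IsManifold (𝓡 n) ∞ M]
    [RiemannianBundle (fun x : M ↦ TangentSpace (𝓡 n) x)]
    [IsContMDiffRiemannianBundle (𝓡 n) ∞ (EuclideanSpace ℝ (Fin n))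
      (fun x : M ↦ TangentSpace (𝓡 n) x)]
    [IsRiemannianManifold (𝓡 n) M] [MeasurableSpace M] [BorelSpace M] :
    ∃ C : ℝ≥0, ∀ Ω : Set M, IsOpen Ω → IsConnected Ω →
      RiemGeom.lambdaOne n Ω ≤ (C : ℝ≥0∞) / RiemGeom.inrad Ω ^ 2 := by
  have := RiemGeom.isContinuousRiemannianBundle_of_isContMDiffRiemannianBundle (IB := 𝓡 n) (k := ∞)
    (F := EuclideanSpace ℝ (Fin n)) (E := fun x : M ↦ TangentSpace (𝓡 n) x)
  exact theorem3_general.imp fun C hC Ω _ _ ↦ hC Ω
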